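/- A Fulkerson cover of a graph is a list of six perfect matchings, not necessarily distinct, such that every edge lies in exactly two of them. Let $k>2$ and let $G_0,\dots,G_{k-1}$ be finite simple cubic graphs, each having a Fulkerson cover. In each $G_i$ fix an edge $x_iy_i$; let $x_i^0,x_i^1$ be the two neighbours of $x_i$ other than $y_i$, and $y_i^0,y_i^1$ the two neighbours of $y_i$ other than $x_i$ (in any order), and let $H_i=G_i\setminus\{x_i,y_i\}$. Define graphs $\Gamma_2,\dots,\Gamma_k$ recursively. $\Gamma_2$ is obtained from the disjoint union of $H_0$ and $H_1$ by adding vertices $a_0,b_0,c_0,a_1,b_1,c_1$ and the 13 edges $a_0y_0^0$, $a_0x_1^0$, $a_0c_0$, $c_0b_0$, $b_0y_0^1$, $b_0x_1^1$, $b_1x_0^1$, $b_1y_1^1$, $b_1c_1$, $c_1a_1$, $a_1x_0^0$, $a_1y_1^0$, $c_0c_1$. For $3\le i\le k$, $\Gamma_i$ is obtained from $\Gamma_{i-1}$ as follows: add (disjointly) $H_{i-1}$ and new vertices $a_{i-1},b_{i-1},c_{i-1}$; subdivide by a new vertex $v_{i-3}$ the edge at $c_0$ other than $a_0c_0$ and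 $b_0c_0$; delete the edges $a_{i-2}x_0^0$ and $b_{i-2}x_0^1$; and add the edges $a_{i-2}x_{i-1}^0$, $b_{i-2}x_{i-1}^1$, $a_{i-1}x_0^0$, $a_{i-1}y_{i-1}^0$, $b_{i-1}x_0^1$, $b_{i-1}y_{i-1}^1$, $c_{i-1}a_{i-1}$, $c_{i-1}b_{i-1}$, $c_{i-1}v_{i-3}$. Let $M_{0,1,\dots,k-1}$ be the family of all graphs (isomorphic to) $\Gamma_k$ arising in this way. Then for every $k>2$, every graph in $M_{0,1,\dots,k-1}$ has a Fulkerson cover. -/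

import Mathlib

universe u

/-- A Fulkerson cover of `G`: six perfect matchings of `G` (repetitions allowed) such that every
edge of `G` lies in exactly two of them. -/
def HasFulkersonCover {V : Type u} (G : SimpleGraph V) : Prop :=
  ∃ M : Fin 6 → G.Subgraph,
    (∀ i, (M i).IsPerfectMatching) ∧
    ∀ e ∈ G.edgeSet, {i : Fin 6 | e ∈ (M i).edgeSet}.ncard = 2

/-- A finite simple cubic graph with a chosen edge `x y`, where `x0, x1` are the two other
neighbours of `x`, in a chosen order, and `y0, y1` those of `y`. It is allowed that one of
`x0, x1` coincides with one of `y0, y1`. -/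
structure MarkedCubicGraph where
  V : Type u
  finite : Finite V
  graph : SimpleGraph V
  cubic : ∀ v, (graph.neighborSet v).ncard = 3
  x : V
  y : V
  x0 : V
  x1 : V
  y0 : V
  y1 : V
  adj_xy : graph.Adj x y
  adj_x0 : graph.Adj x x0
  adj_x1 : graph.Adj x x1
  adj_y0 : graph.Adj y y0
  adj_y1 : graph.Adj y y1
  x0_ne_x1 : x0 ≠ x1
  y0_ne_y1 : y0 ≠ y1
  x0_ne_y : x0 ≠ y
  x1_ne_y : x1 ≠ y
  y0_ne_x : y0 ≠ x
  y1_ne_x : y1 ≠ x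

/-- Names for all the vertices that occur in the recursive construction: the vertices of the
given graphs `P 0, P 1, …` and the extra vertices `a i`, `b i`, `c i`, `v j`. -/
inductive ChenVertex (P : ℕ → MarkedCubicGraph.{u}) : Type u
  | h (i : ℕ) (w : (P i).V) : ChenVertex P
  | a (i : ℕ) : ChenVertex P
  | b (i : ℕ) : ChenVertex P
  | c (i : ℕ) : ChenVertex P
  | v (j : ℕ) : ChenVertex P

namespace ChenVertex

variable (P : ℕ → MarkedCubicGraph.{u})

/-- The vertices of the graph built from `P 0, …, P (k - 1)`: those of each `P i` other than its
`x` and `y`, the vertices `a i, b i, c i` for `i < k`, and `v 0, …, v (k - 3)`. -/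
def verts (k : ℕ) : Set (ChenVertex P) :=
  {p | match p with
    | h i w => i < k ∧ w ≠ (P i).x ∧ w ≠ (P i).y
    | a i => i < k
    | b i => i < k
    | c i => i < k
    | v j => j + 3 ≤ k}

/-- The edges of `P i` that remain after the vertices `x` and `y` of `P i` are deleted. -/
def pieceEdges (i : ℕ) : Set (Sym2 (ChenVertex P)) :=
  {e | ∃ w w' : (P i).V, (P i).graph.Adj w w' ∧
    w ≠ (P i).x ∧ w ≠ (P i).y ∧ w' ≠ (P i).x ∧ w' ≠ (P i).y ∧ e = s(h i w, h i w')}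

/-- In the graph built from the first `k` pieces, the neighbour of `c 0` other than `a 0, b 0`. -/
def hubEnd (k : ℕ) : ChenVertex P :=
  if k ≤ 2 then c 1 else v (k - 3)

/-- The edge set of the graph built from the first `k` pieces (`k ≥ 2`). For `k = 2` it is given
directly. The piece with index `k = n + 2` is added by subdividing, with the new vertex `v n`, the
edge at `c 0` that is neither `a 0 c 0` nor `c 0 b 0`, and by rerouting the edges from
`a (k - 1)`, `b (k - 1)` to the first piece through the new piece and `a k, b k`. -/
def edges : ℕ → Set (Sym2 (ChenVertex P))
  | 0 => ∅
  | 1 => ∅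
  | 2 => pieceEdges P 0 ∪ pieceEdges P 1 ∪
      {s(a 0, h 0 (P 0).y0), s(a 0, h 1 (P 1).x0), s(a 0, c 0), s(c 0, b 0),
        s(b 0, h 0 (P 0).y1), s(b 0, h 1 (P 1).x1),
        s(b 1, h 0 (P 0).x1), s(b 1, h 1 (P 1).y1), s(b 1, c 1), s(c 1, a 1),
        s(a 1, h 0 (P 0).x0), s(a 1, h 1 (P 1).y0), s(c 0, c 1)}
  | n + 3 =>
      (edges (n + 2) \
        {s(a (n + 1), h 0 (P 0).x0), s(b (n + 1), h 0 (P 0).x1), s(c 0, hubEnd P (n + 2))}) ∪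
      pieceEdges P (n + 2) ∪
      {s(c 0, v n), s(v n, hubEnd P (n + 2)),
        s(a (n + 2), h 0 (P 0).x0), s(a (n + 2), h (n + 2) (P (n + 2)).y0),
        s(b (n + 2), h 0 (P 0).x1), s(b (n + 2), h (n + 2) (P (n + 2)).y1),
        s(a (n + 1), h (n + 2) (P (n + 2)).x0), s(b (n + 1), h (n + 2) (P (n + 2)).x1),
        s(c (n + 2), a (n + 2)), s(c (n + 2), b (n + 2)), s(c (n + 2), v n)}

end ChenVertex

/-- The graph built from `P 0, …, P (k - 1)`, for `k ≥ 2`. -/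
def chenGraph (P : ℕ → MarkedCubicGraph.{u}) (k : ℕ) : SimpleGraph (ChenVertex.verts P k) :=
  (SimpleGraph.fromEdgeSet (ChenVertex.edges P k)).induce (ChenVertex.verts P k)

/-- The family `M_{0,1,…,k-1}`, up to isomorphism: the graphs built from cubic graphs
`P 0, …, P (k - 1)` each of which has a Fulkerson cover (the `P i` with `i ≥ k` play no role). -/
def IsChenGraph (k : ℕ) {W : Type u} (Γ : SimpleGraph W) : Prop :=
  2 ≤ k ∧ ∃ P : ℕ → MarkedCubicGraph.{u},
    (∀ i < k, HasFulkersonCover (P i).graph) ∧ Nonempty (Γ ≃g chenGraph P k)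

/-! Unrolled, the graph is a ring of pieces H_i. Between H_i and the next piece sits a junction a_i,
b_i, c_i, and the third edge at c_i (its spoke) leads into a tree formed by the path v_0, …, v_{k-3}
with leaves c_0, …, c_{k-1}. The six matchings are labelled by `Fin 3 × Bool`, that is, two for each
of three colours.

The tree gets a proper 3-edge-colouring, and each edge receives both labels of its colour. Each
piece gets a colour too, whose two labels are those on the deleted edge x_i y_i, so that around the
ring the two pieces at a junction and its spoke have three different colours
(`pieceColour_ne_next`). A matching in the colour of one of these two pieces enters the junction
only from the other piece, through a_i or b_i, and c_i takes the remaining one of a_i, b_i. A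
matching in the spoke colour enters from both pieces, and gluing works exactly when it does so at
different vertices: y^0 must go with x^1, and y^1 with x^0.

To arrange this, the cover of each piece is paired up so that the two labels of every colour other
than its own differ both at x and at y (`exists_separating_pairing`). Each junction then asks for
one parity condition, in its spoke colour only, and swapping the two labels of a colour within a
piece adjusts it. For at least three pieces no colour serves as spoke all the way around the ring,
so these conditions can be met (`exists_bits`). -/

/-! ### Perfect matchings as fixed-point-free partner involutions. -/

/-- A Fulkerson cover of `G` with labels in `L`, presented by the partner `μ l v` of each vertex `v`
in the perfect matching with label `l`. -/
structure IsPartnerCover {V L : Type*} (G : SimpleGraph V) (μ : L → V → V) : Prop where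
  adj : ∀ l v, G.Adj v (μ l v)
  invol : ∀ l v, μ l (μ l v) = v
  card : ∀ v w, G.Adj v w → {l | μ l v = w}.ncard = 2

namespace IsPartnerCover

variable {V L : Type*} {G : SimpleGraph V} {μ : L → V → V}

theorem comp_equiv {L' : Type*} (h : IsPartnerCover G μ) (e : L' ≃ L) :
    IsPartnerCover G (fun l => μ (e l)) where
  adj l := h.adj (e l)
  invol l := h.invol (e l)
  card v w hvw := by
    rw [← h.card v w hvw]
    exact Set.ncard_preimage_of_injective_subset_range (s := {l | μ l v = w}) e.injective (by simp)

theorem congr_iso {W : Type*} {H : SimpleGraph W} (h : IsPartnerCover G μ) (φ : H ≃g G) :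
    IsPartnerCover H (fun l w => φ.symm (μ l (φ w))) where
  adj l w := by
    rw [← φ.map_adj_iff]
    simpa using h.adj l (φ w)
  invol l w := by simp [h.invol]
  card v w hvw := by
    rw [← h.card (φ v) (φ w) (φ.map_adj_iff.2 hvw)]
    congr 1
    ext l
    exact φ.toEquiv.symm_apply_eq

theorem hasFulkersonCover {V : Type u} {G : SimpleGraph V} {μ : Fin 6 → V → V}
    (h : IsPartnerCover G μ) : HasFulkersonCover G := by
  refine ⟨fun l =>
    { verts := Set.univ
      Adj := fun v w => μ l v = w
      adj_sub := fun {v w} hvw => hvw ▸ h.adj l v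
      edge_vert := fun _ => trivial
      symm := ⟨fun v w hvw => by rw [← hvw, h.invol]⟩ }, fun l => ⟨fun v _ => ?_, fun v => trivial⟩,
    fun e => ?_⟩
  · exact ⟨μ l v, rfl, fun w hw => Eq.symm hw⟩
  · induction e using Sym2.ind with
    | _ v w => exact fun hvw => h.card v w hvw

theorem eq_iff (h : IsPartnerCover G μ) {l : L} {v w : V} : μ l v = w ↔ μ l w = v :=
  ⟨fun e => by rw [← e, h.invol], fun e => by rw [← e, h.invol]⟩

end IsPartnerCover

theorem HasFulkersonCover.exists_isPartnerCover {V : Type u} {G : SimpleGraph V}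
    (h : HasFulkersonCover G) : ∃ μ : Fin 6 → V → V, IsPartnerCover G μ := by
  obtain ⟨M, hM, hcard⟩ := h
  choose μ hμ huniq using fun l v => (hM l).1 ((hM l).2 v)
  refine ⟨μ, fun l v => (hμ l v).adj_sub, fun l v => ?_, fun v w hvw => ?_⟩
  · exact (huniq l _ _ (hμ l v).symm).symm
  · rw [← hcard s(v, w) hvw]
    congr 1
    ext l
    exact ⟨fun e => e ▸ hμ l v, fun e => (huniq l v w e).symm⟩

/-! ### Splitting the cover of one marked graph into three pairs. -/

namespace MarkedCubicGraph

variable (G : MarkedCubicGraph.{u})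

theorem adj_x_iff (w : G.V) : G.graph.Adj G.x w ↔ w = G.y ∨ w = G.x0 ∨ w = G.x1 := by
  have hs : ({G.y, G.x0, G.x1} : Set G.V).ncard = 3 :=
    Set.ncard_eq_three.2 ⟨_, _, _, G.x0_ne_y.symm, G.x1_ne_y.symm, G.x0_ne_x1, rfl⟩
  have := Set.eq_of_subset_of_ncard_le (s := {G.y, G.x0, G.x1}) (t := G.graph.neighborSet G.x)
    (by rintro w (rfl | rfl | rfl) <;> simp [G.adj_xy, G.adj_x0, G.adj_x1])
    (by rw [hs, G.cubic]) (Set.finite_of_ncard_ne_zero (by simp [G.cubic]))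
  simpa using (Set.ext_iff.1 this w).symm

theorem adj_y_iff (w : G.V) : G.graph.Adj G.y w ↔ w = G.x ∨ w = G.y0 ∨ w = G.y1 := by
  have hs : ({G.x, G.y0, G.y1} : Set G.V).ncard = 3 :=
    Set.ncard_eq_three.2 ⟨_, _, _, G.y0_ne_x.symm, G.y1_ne_x.symm, G.y0_ne_y1, rfl⟩
  have := Set.eq_of_subset_of_ncard_le (s := {G.x, G.y0, G.y1}) (t := G.graph.neighborSet G.y)
    (by rintro w (rfl | rfl | rfl) <;> simp [G.adj_xy.symm, G.adj_y0, G.adj_y1])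
    (by rw [hs, G.cubic]) (Set.finite_of_ncard_ne_zero (by simp [G.cubic]))
  simpa using (Set.ext_iff.1 this w).symm

end MarkedCubicGraph

/-- Two maps to `Fin 3`, with all fibres of size two and the same fibre over `0`, admit a pairing of
their source which refines that fibre and whose other two pairs are separated by both maps. -/
theorem exists_separating_pairing (X Y : Fin 6 → Fin 3)
    (hX : ∀ c, {l | X l = c}.ncard = 2) (hY : ∀ c, {l | Y l = c}.ncard = 2)
    (hXY : ∀ l, X l = 0 ↔ Y l = 0) :
    ∃ e : Fin 3 × Bool ≃ Fin 6, (∀ l, X (e l) = 0 ↔ l.1 = 0) ∧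
      ∀ c ≠ 0, X (e (c, false)) ≠ X (e (c, true)) ∧ Y (e (c, false)) ≠ Y (e (c, true)) := by
  obtain ⟨u, v, huv, h0⟩ := Set.ncard_eq_two.1 (hX 0)
  obtain ⟨p, q, hpq, h1⟩ := Set.ncard_eq_two.1 (hX 1)
  obtain ⟨r, s, hrs, h2⟩ := Set.ncard_eq_two.1 (hX 2)
  obtain ⟨f, g, hfg, h3⟩ := Set.ncard_eq_two.1 (hY 1)
  simp only [Set.ext_iff, Set.mem_ofPred_eq, Set.mem_insert_iff, Set.mem_singleton_iff]
    at h0 h1 h2 h3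
  -- On `p, q, r, s` the map `Y` takes each of the values 1 and 2 twice. If pairing `p` with `r` and
  -- `q` with `s` fails to separate `Y`, exchanging `r` and `s` succeeds.
  obtain ⟨r, s, hrs, h2, hpr, hqs⟩ : ∃ r s, r ≠ s ∧ (∀ l, X l = 2 ↔ l = r ∨ l = s) ∧
      Y p ≠ Y r ∧ Y q ≠ Y s := by
    by_cases hgood : Y p ≠ Y r ∧ Y q ≠ Y s
    · exact ⟨r, s, hrs, h2, hgood⟩
    · refine ⟨s, r, hrs.symm, fun l => by rw [h2, or_comm], ?_⟩
      have hf : X f = 1 ∨ X f = 2 := by have := hXY f; have := h3 f; grind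
      have hg : X g = 1 ∨ X g = 2 := by have := hXY g; have := h3 g; grind
      grind
  let e : Fin 3 × Bool → Fin 6 := fun l =>
    ![cond l.2 v u, cond l.2 r p, cond l.2 s q] l.1
  have hXe : ∀ l, X (e l) = 0 ↔ l.1 = 0 := by
    rintro ⟨c, b⟩
    fin_cases c <;> cases b <;> simp [e] <;> grind
  have hsurj : Function.Surjective e := by
    intro l
    have : X l = 0 ∨ X l = 1 ∨ X l = 2 := by omega
    rcases this with h | h | h
    · rcases (h0 l).1 h with rfl | rfl
      exacts [⟨(0, false), rfl⟩, ⟨(0, true), rfl⟩]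
    · rcases (h1 l).1 h with rfl | rfl
      exacts [⟨(1, false), rfl⟩, ⟨(2, false), rfl⟩]
    · rcases (h2 l).1 h with rfl | rfl
      exacts [⟨(1, true), rfl⟩, ⟨(2, true), rfl⟩]
  refine ⟨Equiv.ofBijective e ((Fintype.bijective_iff_surjective_and_card e).2
    ⟨hsurj, by simp⟩), hXe, fun c hc => ?_⟩
  have hp := (h1 p).2 (by simp)
  have hq := (h1 q).2 (by simp)
  have hr := (h2 r).2 (by simp)
  have hs := (h2 s).2 (by simp)
  fin_cases c
  · simp at hc
  · exact ⟨by simp [e, hp, hr], hpr⟩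
  · exact ⟨by simp [e, hq, hs], hqs⟩

/-- A partner cover of a marked cubic graph with labels `Fin 3 × Bool`, such that the edge `x y` has
the two labels of colour `α`, and for every other colour `c` the label `(c, β c)` is the one on
`x x0`, and the label `(c, β' c)` is the one on `y y0`. -/
structure IsSplitCover (G : MarkedCubicGraph.{u}) (α : Fin 3) (β β' : Fin 3 → Bool)
    (μ : Fin 3 × Bool → G.V → G.V) : Prop where
  cover : IsPartnerCover G.graph μ
  xy : ∀ l, μ l G.x = G.y ↔ l.1 = α
  x0 : ∀ c ≠ α, ∀ b, μ (c, b) G.x = G.x0 ↔ b = β c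
  y0 : ∀ c ≠ α, ∀ b, μ (c, b) G.y = G.y0 ↔ b = β' c

namespace IsSplitCover

variable {G : MarkedCubicGraph.{u}}

/-- Exchanging the two labels of a colour changes the bit at x and the bit at y together. This is
the only freedom used to fit neighbouring pieces. -/
theorem flip {α : Fin 3} {β β' : Fin 3 → Bool} {μ : Fin 3 × Bool → G.V → G.V}
    (h : IsSplitCover G α β β' μ) (δ : Fin 3 → Bool) :
    IsSplitCover G α (fun c => xor (β c) (δ c)) (fun c => xor (β' c) (δ c))
      (fun l => μ (l.1, xor l.2 (δ l.1))) where
  cover := h.cover.comp_equiv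
    { toFun := fun l => (l.1, xor l.2 (δ l.1))
      invFun := fun l => (l.1, xor l.2 (δ l.1))
      left_inv := fun l => by simp
      right_inv := fun l => by simp }
  xy l := h.xy _
  x0 c hc b := by
    rw [h.x0 c hc]
    cases b <;> cases β c <;> cases δ c <;> simp
  y0 c hc b := by
    rw [h.y0 c hc]
    cases b <;> cases β' c <;> cases δ c <;> simp

end IsSplitCover

/-- Record which edge at x, and which edge at y, each matching uses. The edge x y is common to both
ends, so the two maps to `Fin 3` share their fibre over 0 and a separating pairing exists. -/
theorem exists_isSplitCover (G : MarkedCubicGraph.{u}) (h : HasFulkersonCover G.graph)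
    (α : Fin 3) : ∃ β β' μ, IsSplitCover G α β β' μ := by
  classical
  obtain ⟨μ, hμ⟩ := h.exists_isPartnerCover
  let X : Fin 6 → Fin 3 := fun l => if μ l G.x = G.y then 0 else if μ l G.x = G.x0 then 1 else 2
  let Y : Fin 6 → Fin 3 := fun l => if μ l G.y = G.x then 0 else if μ l G.y = G.y0 then 1 else 2
  have hx l := (G.adj_x_iff _).1 (hμ.adj l G.x)
  have hy l := (G.adj_y_iff _).1 (hμ.adj l G.y)
  have X0 l : X l = 0 ↔ μ l G.x = G.y := by grind
  have X1 l : X l = 1 ↔ μ l G.x = G.x0 := by have := G.x0_ne_y; grind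
  have X2 l : X l = 2 ↔ μ l G.x = G.x1 := by
    have := G.x0_ne_x1; have := G.x1_ne_y; have := hx l; grind
  have Y0 l : Y l = 0 ↔ μ l G.y = G.x := by grind
  have Y1 l : Y l = 1 ↔ μ l G.y = G.y0 := by have := G.y0_ne_x; grind
  have Y2 l : Y l = 2 ↔ μ l G.y = G.y1 := by
    have := G.y0_ne_y1; have := G.y1_ne_x; have := hy l; grind
  obtain ⟨e, he, hsep⟩ := exists_separating_pairing X Y
    (by
      intro c
      fin_cases c
      · simpa [X0] using hμ.card _ _ G.adj_xy
      · simpa [X1] using hμ.card _ _ G.adj_x0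
      · simpa [X2] using hμ.card _ _ G.adj_x1)
    (by
      intro c
      fin_cases c
      · simpa [Y0] using hμ.card _ _ G.adj_xy.symm
      · simpa [Y1] using hμ.card _ _ G.adj_y0
      · simpa [Y2] using hμ.card _ _ G.adj_y1)
    (fun l => by rw [X0, Y0, hμ.eq_iff])
  -- On a separated pair that avoids 0, `Z` takes the values 1 and 2 once each, so its value at
  -- `true` determines where it is 1.
  have key : ∀ Z : Fin 6 → Fin 3, (∀ l, Z (e l) = 0 ↔ l.1 = 0) →
      (∀ c ≠ 0, Z (e (c, false)) ≠ Z (e (c, true))) → ∀ c ≠ 0, ∀ b,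
      (Z (e (c, b)) = 1 ↔ b = decide (Z (e (c, true)) = 1)) := by
    intro Z hZ hs c hc b
    have h1 := hZ (c, false)
    have h2 := hZ (c, true)
    have h3 := hs c hc
    have h4 : ∀ i : Fin 3, i = 0 ∨ i = 1 ∨ i = 2 := by decide
    have h5 := h4 (Z (e (c, false)))
    have h6 := h4 (Z (e (c, true)))
    cases b <;> grind
  have hYe : ∀ l, Y (e l) = 0 ↔ l.1 = 0 := fun l => by rw [← he, X0, Y0, hμ.eq_iff]
  -- A cyclic shift of the colours moves the colour of x y from 0 to `α`.
  let σ : Fin 3 × Bool ≃ Fin 3 × Bool := (Equiv.subRight α).prodCongr (Equiv.refl Bool)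
  have hσ c b : σ (c, b) = (c - α, b) := rfl
  refine ⟨fun c => decide (X (e (c - α, true)) = 1), fun c => decide (Y (e (c - α, true)) = 1),
    fun l => μ (e (σ l)), hμ.comp_equiv (σ.trans e), fun l => ?_, fun c hc b => ?_, fun c hc b => ?_⟩
  · rw [← X0, he, ← Prod.mk.eta (p := l), hσ]
    exact sub_eq_zero
  · rw [← X1, hσ]
    exact key X he (fun c hc => (hsep c hc).1) _ (sub_ne_zero.2 hc) b
  · rw [← Y1, hσ]
    exact key Y hYe (fun c hc => (hsep c hc).2) _ (sub_ne_zero.2 hc) b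

/-! ### The recursive construction unrolled. -/

namespace ChenVertex

variable (P : ℕ → MarkedCubicGraph.{u})

/-- The edges of the graph built from `n + 2` pieces, listed without recursion; the pieces are
arranged cyclically, each followed by the vertices `a i, b i, c i`. -/
inductive IsEdge (n : ℕ) : Sym2 (ChenVertex P) → Prop
  | piece (i : ℕ) (hi : i < n + 2) (e) (he : e ∈ pieceEdges P i) : IsEdge n e
  | a_y (i : ℕ) (hi : i < n + 2) : IsEdge n s(a i, h i (P i).y0)
  | b_y (i : ℕ) (hi : i < n + 2) : IsEdge n s(b i, h i (P i).y1)
  | a_c (i : ℕ) (hi : i < n + 2) : IsEdge n s(a i, c i)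
  | b_c (i : ℕ) (hi : i < n + 2) : IsEdge n s(b i, c i)
  | a_x (i : ℕ) (hi : i < n + 1) : IsEdge n s(a i, h (i + 1) (P (i + 1)).x0)
  | b_x (i : ℕ) (hi : i < n + 1) : IsEdge n s(b i, h (i + 1) (P (i + 1)).x1)
  | a_x_last : IsEdge n s(a (n + 1), h 0 (P 0).x0)
  | b_x_last : IsEdge n s(b (n + 1), h 0 (P 0).x1)
  | hub : IsEdge n s(c 0, hubEnd P (n + 2))
  | c_v (j : ℕ) (hj : j < n) : IsEdge n s(c (j + 2), v j)
  | v_hub (j : ℕ) (hj : j < n) : IsEdge n s(v j, hubEnd P (j + 2))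

theorem hubEnd_add_three (j : ℕ) : hubEnd P (j + 3) = v j := by simp [hubEnd]

theorem hubEnd_two : hubEnd P 2 = c 1 := by simp [hubEnd]

theorem hubEnd_ne_a (k i : ℕ) : hubEnd P k ≠ a i := by
  unfold hubEnd; split_ifs <;> simp

theorem hubEnd_ne_b (k i : ℕ) : hubEnd P k ≠ b i := by
  unfold hubEnd; split_ifs <;> simp

theorem hubEnd_ne_c_zero (k : ℕ) : hubEnd P k ≠ c 0 := by
  unfold hubEnd; split_ifs <;> simp

/-- Each recursive step deletes only the two edges closing the ring and the hub edge. These are the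
constructors `a_x_last`, `b_x_last` and `hub`, the only ones whose edge changes with `n`. -/
theorem mem_edges_iff (n : ℕ) (e : Sym2 (ChenVertex P)) : e ∈ edges P (n + 2) ↔ IsEdge P n e := by
  induction n with
  | zero =>
    simp only [edges, Set.mem_union, Set.mem_insert_iff, Set.mem_singleton_iff]
    constructor
    · rintro ((he | he) | rfl | rfl | rfl | rfl | rfl | rfl | rfl | rfl | rfl | rfl | rfl | rfl | rfl)
      · exact .piece 0 (by omega) e he
      · exact .piece 1 (by omega) e he
      · exact .a_y 0 (by omega)
      · exact .a_x 0 (by omega)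
      · exact .a_c 0 (by omega)
      · exact Sym2.eq_swap ▸ .b_c 0 (by omega)
      · exact .b_y 0 (by omega)
      · exact .b_x 0 (by omega)
      · exact .b_x_last
      · exact .b_y 1 (by omega)
      · exact .b_c 1 (by omega)
      · exact Sym2.eq_swap ▸ .a_c 1 (by omega)
      · exact .a_x_last
      · exact .a_y 1 (by omega)
      · exact .hub
    · intro he
      cases he with
      | piece i hi e he => interval_cases i <;> simp [he]
      | a_y i hi => interval_cases i <;> simp
      | b_y i hi => interval_cases i <;> simp
      | a_c i hi => interval_cases i <;> simp
      | b_c i hi => interval_cases i <;> simp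
      | a_x i hi => interval_cases i; simp
      | b_x i hi => interval_cases i; simp
      | a_x_last => simp
      | b_x_last => simp
      | hub => simp [hubEnd_two]
      | c_v j hj => omega
      | v_hub j hj => omega
  | succ n ih =>
    rw [edges]
    simp only [Set.mem_union, Set.mem_insert_iff, Set.mem_singleton_iff, Set.mem_sdiff, ih]
    constructor
    · rintro ((⟨he, hne⟩ | he) | rfl | rfl | rfl | rfl | rfl | rfl | rfl | rfl | rfl | rfl | rfl)
      · cases he with
        | piece i hi e he => exact .piece i (by omega) e he
        | a_y i hi => exact .a_y i (by omega)
        | b_y i hi => exact .b_y i (by omega)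
        | a_c i hi => exact .a_c i (by omega)
        | b_c i hi => exact .b_c i (by omega)
        | a_x i hi => exact .a_x i (by omega)
        | b_x i hi => exact .b_x i (by omega)
        | a_x_last => simp at hne
        | b_x_last => simp at hne
        | hub => simp at hne
        | c_v j hj => exact .c_v j (by omega)
        | v_hub j hj => exact .v_hub j (by omega)
      · exact .piece _ (by omega) _ he
      · rw [← hubEnd_add_three]; exact .hub
      · exact .v_hub n (by omega)
      · exact .a_x_last
      · exact .a_y _ (by omega)
      · exact .b_x_last
      · exact .b_y _ (by omega)
      · exact .a_x _ (by omega)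
      · exact .b_x _ (by omega)
      · exact Sym2.eq_swap ▸ .a_c _ (by omega)
      · exact Sym2.eq_swap ▸ .b_c _ (by omega)
      · exact .c_v _ (by omega)
    · intro he
      have hne : ∀ e, IsEdge P n e → e ≠ s(a (n + 1), h 0 (P 0).x0) → e ≠ s(b (n + 1), h 0 (P 0).x1) →
          e ≠ s(c 0, hubEnd P (n + 2)) → IsEdge P n e ∧ ¬(e = s(a (n + 1), h 0 (P 0).x0) ∨
            e = s(b (n + 1), h 0 (P 0).x1) ∨ e = s(c 0, hubEnd P (n + 2))) := by
        intro e he h1 h2 h3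
        exact ⟨he, by simp [h1, h2, h3]⟩
      cases he with
      | piece i hi e he =>
        rcases Nat.lt_succ_iff_lt_or_eq.1 hi with hi | rfl
        · refine .inl (.inl (hne _ (.piece i hi e he) ?_ ?_ ?_)) <;>
          · obtain ⟨w, w', -, -, -, -, -, rfl⟩ := he
            simp
        · exact .inl (.inr he)
      | a_y i hi =>
        rcases Nat.lt_succ_iff_lt_or_eq.1 hi with hi | rfl
        · refine .inl (.inl (hne _ (.a_y i hi) ?_ ?_ ?_)) <;> simp
          rintro rfl; simp
        · simp
      | b_y i hi =>
        rcases Nat.lt_succ_iff_lt_or_eq.1 hi with hi | rfl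
        · refine .inl (.inl (hne _ (.b_y i hi) ?_ ?_ ?_)) <;> simp
          rintro rfl; simp
        · simp
      | a_c i hi =>
        rcases Nat.lt_succ_iff_lt_or_eq.1 hi with hi | rfl
        · refine .inl (.inl (hne _ (.a_c i hi) ?_ ?_ ?_)) <;>
            simp [(hubEnd_ne_a P _ _).symm]
        · simp [Sym2.eq_swap]
      | b_c i hi =>
        rcases Nat.lt_succ_iff_lt_or_eq.1 hi with hi | rfl
        · refine .inl (.inl (hne _ (.b_c i hi) ?_ ?_ ?_)) <;>
            simp [(hubEnd_ne_b P _ _).symm]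
        · simp
      | a_x i hi =>
        rcases Nat.lt_succ_iff_lt_or_eq.1 hi with hi | rfl
        · refine .inl (.inl (hne _ (.a_x i hi) ?_ ?_ ?_)) <;> simp
        · simp
      | b_x i hi =>
        rcases Nat.lt_succ_iff_lt_or_eq.1 hi with hi | rfl
        · refine .inl (.inl (hne _ (.b_x i hi) ?_ ?_ ?_)) <;> simp
        · simp
      | a_x_last => simp
      | b_x_last => simp
      | hub => simp [hubEnd_add_three]
      | c_v j hj =>
        rcases Nat.lt_succ_iff_lt_or_eq.1 hj with hj | rfl
        · refine .inl (.inl (hne _ (.c_v j hj) ?_ ?_ ?_)) <;> simp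
        · simp
      | v_hub j hj =>
        rcases Nat.lt_succ_iff_lt_or_eq.1 hj with hj | rfl
        · refine .inl (.inl (hne _ (.v_hub j hj) ?_ ?_ ?_)) <;> simp [hubEnd_ne_c_zero]
        · simp

end ChenVertex

/-! ### Colours, and the glued matchings. -/

namespace ChenVertex

/-- The colours `1, 2, 1, 2, …`. -/
def altColour (j : ℕ) : Fin 3 := if Even j then 1 else 2

/-- The colour given to the edge `x y` of the piece with index `i`, out of `n + 3` pieces. -/
def pieceColour (n : ℕ) : ℕ → Fin 3
  | 0 => altColour (n + 1)
  | 1 => 0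
  | j + 2 => altColour j

/-- The colour given to the edge at `c i` other than `a i c i` and `b i c i`. -/
def spokeColour (n : ℕ) : ℕ → Fin 3
  | 0 => altColour n
  | 1 => 2
  | _ + 2 => 0

/-- The cyclic successor on the indices of `n + 3` pieces. -/
def next (n i : ℕ) : ℕ := if i = n + 2 then 0 else i + 1

/-- The cyclic predecessor on the indices of `n + 3` pieces. -/
def prev (n : ℕ) : ℕ → ℕ
  | 0 => n + 2
  | i + 1 => i

theorem next_prev {n i : ℕ} (hi : i < n + 3) : next n (prev n i) = i := by
  cases i <;> grind [next, prev]

theorem prev_next {n i : ℕ} : prev n (next n i) = i := by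
  unfold next; split_ifs with h <;> simp [prev, h]

theorem next_lt {n i : ℕ} (hi : i < n + 3) : next n i < n + 3 := by grind [next]

theorem prev_lt {n i : ℕ} (hi : i < n + 3) : prev n i < n + 3 := by cases i <;> grind [prev]

theorem next_ne {n i : ℕ} : next n i ≠ i := by grind [next]

theorem altColour_succ_ne (j : ℕ) : altColour (j + 1) ≠ altColour j := by
  by_cases h : Even j <;> simp [altColour, h, Nat.even_add_one]

theorem altColour_ne_zero (j : ℕ) : altColour j ≠ 0 := by
  unfold altColour; split_ifs <;> decide

theorem eq_or_eq_or_eq {p q r : Fin 3} (hpq : p ≠ q) (hpr : p ≠ r) (hqr : q ≠ r) (s : Fin 3) :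
    s = p ∨ s = q ∨ s = r := by
  omega

/-- Pieces 2, 3, …, n + 2, 0 alternate between 1 and 2, and piece 1 breaks the ring with colour 0,
so the parity of the number of pieces does not matter. The spoke takes the missing colour. -/
theorem pieceColour_ne_next {n i : ℕ} (hi : i < n + 3) :
    pieceColour n i ≠ pieceColour n (next n i) ∧ spokeColour n i ≠ pieceColour n i ∧
      spokeColour n i ≠ pieceColour n (next n i) := by
  match i with
  | 0 =>
    simpa [next, pieceColour, spokeColour, altColour_ne_zero] using (altColour_succ_ne n).symm
  | 1 => simp [next, pieceColour, spokeColour, altColour]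
  | j + 2 =>
    by_cases h : j = n
    · subst h
      simpa [next, pieceColour, spokeColour, (altColour_ne_zero _).symm]
        using (altColour_succ_ne j).symm
    · simpa [next, h, pieceColour, spokeColour, (altColour_ne_zero _).symm]
        using (altColour_succ_ne j).symm

variable {P : ℕ → MarkedCubicGraph.{u}} (n : ℕ) (μ : ∀ i, Fin 3 × Bool → (P i).V → (P i).V)

/-- Partner covers of the first `n + 3` pieces which can be glued to one of the whole graph. -/
structure IsGluable : Prop where
  cover : ∀ i < n + 3, IsPartnerCover (P i).graph (μ i)
  xy : ∀ i < n + 3, ∀ l, μ i l (P i).x = (P i).y ↔ l.1 = pieceColour n i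
  junction : ∀ i < n + 3, ∀ l, l.1 = spokeColour n i → (μ i l (P i).y = (P i).y0 ↔
    μ (next n i) l (P (next n i)).x = (P (next n i)).x1)

/-- The neighbour of `c i` other than `a i` and `b i`. -/
def spokeEnd : ℕ → ChenVertex P
  | 0 => v n
  | 1 => v 0
  | j + 2 => v j

open Classical in
/-- The vertex which replaces the neighbour `w'` of `w` in the piece with index `i`. -/
noncomputable def port (i : ℕ) (w w' : (P i).V) : ChenVertex P :=
  if w' = (P i).x then if w = (P i).x0 then a (prev n i) else b (prev n i)
  else if w' = (P i).y then if w = (P i).y0 then a i else b i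
  else h i w'

open Classical in
/-- The partner cover of the whole graph glued from partner covers of the pieces. -/
noncomputable def glue (l : Fin 3 × Bool) : ChenVertex P → ChenVertex P
  | h i w => port n i w (μ i l w)
  | a i =>
    if μ i l (P i).y = (P i).y0 then h i (P i).y0
    else if μ (next n i) l (P (next n i)).x = (P (next n i)).x0 then
      h (next n i) (P (next n i)).x0
    else c i
  | b i =>
    if μ i l (P i).y = (P i).y1 then h i (P i).y1
    else if μ (next n i) l (P (next n i)).x = (P (next n i)).x1 then
      h (next n i) (P (next n i)).x1
    else c i
  | c i =>
    if l.1 = spokeColour n i then spokeEnd n i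
    else if μ i l (P i).y = (P i).y0 ∨
      μ (next n i) l (P (next n i)).x = (P (next n i)).x0 then b i
    else a i
  | v j =>
    if l.1 = 0 then c (j + 2)
    else if l.1 = altColour j then if j = n then c 0 else v (j + 1)
    else hubEnd P (j + 2)

variable {n μ}

theorem IsGluable.y_cases (H : IsGluable n μ) {i : ℕ} (hi : i < n + 3) (l : Fin 3 × Bool) :
    (l.1 = pieceColour n i ∧ ¬ μ i l (P i).y = (P i).y0 ∧ ¬ μ i l (P i).y = (P i).y1) ∨
    (l.1 ≠ pieceColour n i ∧ μ i l (P i).y = (P i).y0 ∧ ¬ μ i l (P i).y = (P i).y1) ∨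
    (l.1 ≠ pieceColour n i ∧ ¬ μ i l (P i).y = (P i).y0 ∧ μ i l (P i).y = (P i).y1) := by
  have h1 := ((P i).adj_y_iff _).1 ((H.cover i hi).adj l (P i).y)
  have h2 := (H.cover i hi).eq_iff.symm.trans (H.xy i hi l)
  have := (P i).y0_ne_y1
  have := (P i).y0_ne_x
  have := (P i).y1_ne_x
  grind

theorem IsGluable.x_cases (H : IsGluable n μ) {i : ℕ} (hi : i < n + 3) (l : Fin 3 × Bool) :
    (l.1 = pieceColour n i ∧ ¬ μ i l (P i).x = (P i).x0 ∧ ¬ μ i l (P i).x = (P i).x1) ∨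
    (l.1 ≠ pieceColour n i ∧ μ i l (P i).x = (P i).x0 ∧ ¬ μ i l (P i).x = (P i).x1) ∨
    (l.1 ≠ pieceColour n i ∧ ¬ μ i l (P i).x = (P i).x0 ∧ μ i l (P i).x = (P i).x1) := by
  have h1 := ((P i).adj_x_iff _).1 ((H.cover i hi).adj l (P i).x)
  have h2 := H.xy i hi l
  have := (P i).x0_ne_x1
  have := (P i).x0_ne_y
  have := (P i).x1_ne_y
  grind

/-- The possible local pictures of one matching around `a i, b i, c i`: it leaves that triple
through the spoke at `c i`, through the piece with index `i`, or through the next piece. -/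
theorem IsGluable.junction_cases (H : IsGluable n μ) {i : ℕ} (hi : i < n + 3)
    (l : Fin 3 × Bool) {Yp Yq Xp Xq : Prop} (hYp : Yp ↔ μ i l (P i).y = (P i).y0)
    (hYq : Yq ↔ μ i l (P i).y = (P i).y1)
    (hXp : Xp ↔ μ (next n i) l (P (next n i)).x = (P (next n i)).x0)
    (hXq : Xq ↔ μ (next n i) l (P (next n i)).x = (P (next n i)).x1) :
    (l.1 = spokeColour n i ∧ Yp ∧ ¬ Yq ∧ ¬ Xp ∧ Xq) ∨
    (l.1 = spokeColour n i ∧ ¬ Yp ∧ Yq ∧ Xp ∧ ¬ Xq) ∨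
    (l.1 ≠ spokeColour n i ∧ Yp ∧ ¬ Yq ∧ ¬ Xp ∧ ¬ Xq) ∨
    (l.1 ≠ spokeColour n i ∧ ¬ Yp ∧ Yq ∧ ¬ Xp ∧ ¬ Xq) ∨
    (l.1 ≠ spokeColour n i ∧ ¬ Yp ∧ ¬ Yq ∧ Xp ∧ ¬ Xq) ∨
    (l.1 ≠ spokeColour n i ∧ ¬ Yp ∧ ¬ Yq ∧ ¬ Xp ∧ Xq) := by
  have h1 := H.y_cases hi l
  have h2 := H.x_cases (next_lt hi) l
  have h3 := H.junction i hi l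
  obtain ⟨h4, h5, h6⟩ := pieceColour_ne_next hi
  have h7 := eq_or_eq_or_eq h4 h5.symm h6.symm l.1
  rw [← hYp, ← hYq] at h1
  rw [← hXp, ← hXq] at h2
  rw [← hYp, ← hXq] at h3
  clear hYp hYq hXp hXq
  generalize pieceColour n (next n i) = c₃ at *
  generalize pieceColour n i = c₁ at *
  generalize spokeColour n i = c₂ at *
  generalize l.1 = c at *
  -- Once the three colours are abstract and distinct, only a finite propositional check remains.
  rcases h1 with h1 | h1 | h1 <;> rcases h2 with h2 | h2 | h2 <;> grind

theorem mem_verts {k : ℕ} {p : ChenVertex P} : p ∈ verts P k ↔ match p with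
    | h i w => i < k ∧ w ≠ (P i).x ∧ w ≠ (P i).y
    | a i => i < k
    | b i => i < k
    | c i => i < k
    | v j => j + 3 ≤ k := Iff.rfl

theorem glue_x0 (H : IsGluable n μ) {i : ℕ} (hi : i < n + 3) {l : Fin 3 × Bool}
    (hl : μ i l (P i).x = (P i).x0) : glue n μ l (h i (P i).x0) = a (prev n i) := by
  simp [glue, port, (H.cover i hi).eq_iff.1 hl]

theorem glue_x1 (H : IsGluable n μ) {i : ℕ} (hi : i < n + 3) {l : Fin 3 × Bool}
    (hl : μ i l (P i).x = (P i).x1) : glue n μ l (h i (P i).x1) = b (prev n i) := by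
  simp [glue, port, (H.cover i hi).eq_iff.1 hl, (P i).x0_ne_x1.symm]

theorem glue_y0 (H : IsGluable n μ) {i : ℕ} (hi : i < n + 3) {l : Fin 3 × Bool}
    (hl : μ i l (P i).y = (P i).y0) : glue n μ l (h i (P i).y0) = a i := by
  simp [glue, port, (H.cover i hi).eq_iff.1 hl, (P i).adj_xy.ne.symm]

theorem glue_y1 (H : IsGluable n μ) {i : ℕ} (hi : i < n + 3) {l : Fin 3 × Bool}
    (hl : μ i l (P i).y = (P i).y1) : glue n μ l (h i (P i).y1) = b i := by
  simp [glue, port, (H.cover i hi).eq_iff.1 hl, (P i).adj_xy.ne.symm, (P i).y0_ne_y1.symm]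

theorem glue_spokeEnd (i : ℕ) (hi : i < n + 3) {l : Fin 3 × Bool} (hl : l.1 = spokeColour n i) :
    glue n μ l (spokeEnd n i) = c i := by
  match i with
  | 0 => simp [spokeEnd, glue, hl, spokeColour, altColour_ne_zero]
  | 1 => simp [spokeEnd, glue, hl, spokeColour, altColour, hubEnd_two]
  | j + 2 => simp [spokeEnd, glue, hl, spokeColour]

/-- The edge from `v j` back towards `c 1` has colour `altColour (j + 1)`. Seen from its other end
this is the forward colour, because `altColour` has period two. -/
theorem glue_hubEnd {j : ℕ} {l : Fin 3 × Bool} (hj : j ≤ n) (hl : l.1 = altColour (j + 1)) :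
    glue n μ l (hubEnd P (j + 2)) = v j := by
  cases j with
  | zero => simp [hubEnd_two, glue, hl, spokeColour, spokeEnd, altColour]
  | succ j =>
    have : altColour (j + 1 + 1) = altColour j := by simp [altColour, Nat.even_add_one]
    have hj : j ≠ n := by omega
    simp [hubEnd_add_three, glue, hl, this, hj, altColour_ne_zero]

theorem spokeEnd_mem (i : ℕ) (hi : i < n + 3) : spokeEnd n i ∈ verts P (n + 3) := by
  match i with
  | 0 => simp [spokeEnd, mem_verts]
  | 1 => simp [spokeEnd, mem_verts]
  | j + 2 => simp only [spokeEnd, mem_verts]; omega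

theorem hubEnd_mem (j : ℕ) (hj : j ≤ n) : hubEnd P (j + 2) ∈ verts P (n + 3) := by
  cases j with
  | zero => simp [hubEnd_two, mem_verts]
  | succ j => simp only [hubEnd_add_three, mem_verts]; omega

theorem glue_mem (l : Fin 3 × Bool) {p : ChenVertex P}
    (hp : p ∈ verts P (n + 3)) : glue n μ l p ∈ verts P (n + 3) := by
  cases p with
  | h i w =>
    obtain ⟨hi, hx, hy⟩ := hp
    have := prev_lt hi
    simp only [glue, port]
    split_ifs <;> simp_all [mem_verts]
  | a i =>
    have hi : i < n + 3 := hp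
    have := next_lt hi
    have := (P i).adj_y0.ne'
    have := (P (next n i)).adj_x0.ne'
    simp only [glue]
    split_ifs <;> simp_all [mem_verts, (P i).y0_ne_x, (P (next n i)).x0_ne_y]
  | b i =>
    have hi : i < n + 3 := hp
    have := next_lt hi
    have := (P i).adj_y1.ne'
    have := (P (next n i)).adj_x1.ne'
    simp only [glue]
    split_ifs <;> simp_all [mem_verts, (P i).y1_ne_x, (P (next n i)).x1_ne_y]
  | c i =>
    have hi : i < n + 3 := hp
    have := spokeEnd_mem (P := P) i hi
    simp only [glue]
    split_ifs <;> simp_all [mem_verts]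
  | v j =>
    have hj : j + 3 ≤ n + 3 := hp
    have := hubEnd_mem (P := P) (n := n) j (by omega)
    simp only [glue]
    split_ifs <;> try assumption
    all_goals simp only [mem_verts]; omega

theorem glue_glue (H : IsGluable n μ) (l : Fin 3 × Bool) {p : ChenVertex P}
    (hp : p ∈ verts P (n + 3)) : glue n μ l (glue n μ l p) = p := by
  cases p with
  | h i w =>
    obtain ⟨hi, hx, hy⟩ := hp
    have hprev := prev_lt hi
    have hc := (H.cover i hi)
    -- The x side of piece `i` belongs to the preceding junction. If the matching enters `a` or `b`
    -- from here, it does not enter the same vertex from the piece before.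
    have hj := H.junction_cases hprev l Iff.rfl Iff.rfl Iff.rfl Iff.rfl
    rw [next_prev hi] at hj
    by_cases h1 : μ i l w = (P i).x
    · have h2 := hc.eq_iff.1 h1
      rcases ((P i).adj_x_iff w).1 (h2 ▸ hc.adj l _) with rfl | rfl | rfl
      · exact absurd rfl hy
      · rw [glue_x0 H hi h2, glue, next_prev hi, if_neg (by tauto), if_pos h2]
      · rw [glue_x1 H hi h2, glue, next_prev hi, if_neg (by tauto), if_pos h2]
    by_cases h3 : μ i l w = (P i).y
    · have h2 := hc.eq_iff.1 h3
      rcases ((P i).adj_y_iff w).1 (h2 ▸ hc.adj l _) with rfl | rfl | rfl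
      · exact absurd rfl hx
      · rw [glue_y0 H hi h2, glue, if_pos h2]
      · rw [glue_y1 H hi h2, glue, if_pos h2]
    · simp [glue, port, h1, h3, hx, hy, hc.invol]
  | a i =>
    have hi : i < n + 3 := hp
    have hj := H.junction_cases hi l Iff.rfl Iff.rfl Iff.rfl Iff.rfl
    rw [glue]
    split_ifs with h1 h2
    · exact glue_y0 H hi h1
    · rw [glue_x0 H (next_lt hi) h2, prev_next]
    · rw [glue, if_neg (by tauto), if_neg (by tauto)]
  | b i =>
    have hi : i < n + 3 := hp
    have hj := H.junction_cases hi l Iff.rfl Iff.rfl Iff.rfl Iff.rfl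
    rw [glue]
    split_ifs with h1 h2
    · exact glue_y1 H hi h1
    · rw [glue_x1 H (next_lt hi) h2, prev_next]
    · rw [glue, if_neg (by tauto), if_pos (by tauto)]
  | c i =>
    have hi : i < n + 3 := hp
    have hj := H.junction_cases hi l Iff.rfl Iff.rfl Iff.rfl Iff.rfl
    rw [glue]
    split_ifs with h1 h2
    · exact glue_spokeEnd i hi h1
    · rw [glue, if_neg (by tauto), if_neg (by tauto)]
    · rw [glue, if_neg (by tauto), if_neg (by tauto)]
  | v j =>
    have hj : j ≤ n := by have : j + 3 ≤ n + 3 := hp; omega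
    rw [glue]
    split_ifs with h1 h2 h3
    · simp [glue, spokeColour, spokeEnd, h1]
    · simp [glue, spokeColour, spokeEnd, h2, h3]
    · rw [glue, if_neg h1, if_neg (h2 ▸ (altColour_succ_ne j).symm), hubEnd_add_three]
    · refine glue_hubEnd hj ?_
      have := eq_or_eq_or_eq (altColour_ne_zero j).symm (altColour_ne_zero (j + 1)).symm
        (altColour_succ_ne j).symm l.1
      tauto

end ChenVertex

/-! ### Each edge lies in exactly two glued matchings. -/

namespace ChenVertex

variable {P : ℕ → MarkedCubicGraph.{u}} {n : ℕ}
  {μ : ∀ i, Fin 3 × Bool → (P i).V → (P i).V}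

theorem IsEdge.not_isDiag {e : Sym2 (ChenVertex P)} (he : IsEdge P n e) : ¬ e.IsDiag := by
  cases he with
  | piece i hi e he =>
    obtain ⟨w, w', hw, -, -, -, -, rfl⟩ := he
    simpa using hw.ne
  | hub => simpa using (hubEnd_ne_c_zero P _).symm
  | v_hub j hj => cases j <;> simp [hubEnd_two, hubEnd_add_three]
  | _ => simp

theorem isEdge_a_next {i : ℕ} (hi : i < n + 3) :
    IsEdge P (n + 1) s(a i, h (next n i) (P (next n i)).x0) := by
  by_cases h : i = n + 2
  · subst h; rw [next, if_pos rfl]; exact .a_x_last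
  · rw [next, if_neg h]; exact .a_x i (by omega)

theorem isEdge_b_next {i : ℕ} (hi : i < n + 3) :
    IsEdge P (n + 1) s(b i, h (next n i) (P (next n i)).x1) := by
  by_cases h : i = n + 2
  · subst h; rw [next, if_pos rfl]; exact .b_x_last
  · rw [next, if_neg h]; exact .b_x i (by omega)

theorem isEdge_spokeEnd {i : ℕ} (hi : i < n + 3) :
    IsEdge P (n + 1) s(c i, spokeEnd n i) := by
  match i with
  | 0 => exact congrArg (fun p => s(c 0, p)) (hubEnd_add_three P n) ▸ .hub
  | 1 => exact hubEnd_two P ▸ Sym2.eq_swap ▸ .v_hub 0 (by omega)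
  | j + 2 => exact .c_v j (by omega)

theorem isEdge_glue (H : IsGluable n μ) (l : Fin 3 × Bool) {p : ChenVertex P}
    (hp : p ∈ verts P (n + 3)) : IsEdge P (n + 1) s(p, glue n μ l p) := by
  cases p with
  | h i w =>
    obtain ⟨hi, hx, hy⟩ := hp
    have hc := H.cover i hi
    have hadj := hc.adj l w
    rw [glue, port]
    split_ifs with h1 h2 h2 h3
    · have := isEdge_a_next (P := P) (prev_lt hi)
      rw [next_prev hi] at this
      rwa [Sym2.eq_swap, h2]
    · have := isEdge_b_next (P := P) (prev_lt hi)
      rw [next_prev hi] at this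
      have hw : w = (P i).x1 := by
        have := ((P i).adj_x_iff w).1 (h1 ▸ hadj.symm); tauto
      rwa [Sym2.eq_swap, hw]
    · rw [Sym2.eq_swap, h3]; exact .a_y i hi
    · have hw : w = (P i).y1 := by
        have := ((P i).adj_y_iff w).1 (h2 ▸ hadj.symm); tauto
      rw [Sym2.eq_swap, hw]; exact .b_y i hi
    · exact .piece i hi _ ⟨_, _, hadj, hx, hy, h1, h2, rfl⟩
  | a i =>
    rw [glue]
    split_ifs
    exacts [.a_y i hp, isEdge_a_next hp, .a_c i hp]
  | b i =>
    rw [glue]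
    split_ifs
    exacts [.b_y i hp, isEdge_b_next hp, .b_c i hp]
  | c i =>
    rw [glue]
    split_ifs
    exacts [isEdge_spokeEnd hp, Sym2.eq_swap ▸ .b_c i hp, Sym2.eq_swap ▸ .a_c i hp]
  | v j =>
    have hj : j + 3 ≤ n + 3 := hp
    rw [glue]
    split_ifs with h1 h2 h3
    · exact Sym2.eq_swap ▸ .c_v j (by omega)
    · rw [Sym2.eq_swap, h3, ← hubEnd_add_three]; exact .hub
    · rw [Sym2.eq_swap, ← hubEnd_add_three]; exact .v_hub (j + 1) (by omega)
    · exact .v_hub j (by omega)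

theorem ncard_colour (c : Fin 3) : {l : Fin 3 × Bool | l.1 = c}.ncard = 2 := by
  rw [Set.ncard_eq_toFinset_card']
  revert c
  decide

theorem ncard_neither {s t : Set (Fin 3 × Bool)} (hs : s.ncard = 2) (ht : t.ncard = 2)
    (hst : Disjoint s t) : (s ∪ t)ᶜ.ncard = 2 := by
  have h1 := Set.ncard_add_ncard_compl (s ∪ t)
  rw [Set.ncard_union_eq hst, hs, ht] at h1
  simp only [Nat.card_eq_fintype_card, Fintype.card_prod, Fintype.card_fin,
    Fintype.card_bool] at h1
  omega

theorem ncard_glue_a_next (H : IsGluable n μ) {i : ℕ} (hi : i < n + 3) :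
    {l | glue n μ l (a i) = h (next n i) (P (next n i)).x0}.ncard = 2 := by
  rw [← (H.cover _ (next_lt hi)).card _ _ (P (next n i)).adj_x0]
  congr 1
  ext l
  have hj := H.junction_cases hi l Iff.rfl Iff.rfl Iff.rfl Iff.rfl
  have := next_ne (n := n) (i := i)
  simp only [glue, Set.mem_ofPred_eq]
  split_ifs <;> simp [this.symm] <;> grind

theorem ncard_glue_b_next (H : IsGluable n μ) {i : ℕ} (hi : i < n + 3) :
    {l | glue n μ l (b i) = h (next n i) (P (next n i)).x1}.ncard = 2 := by
  rw [← (H.cover _ (next_lt hi)).card _ _ (P (next n i)).adj_x1]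
  congr 1
  ext l
  have hj := H.junction_cases hi l Iff.rfl Iff.rfl Iff.rfl Iff.rfl
  have := next_ne (n := n) (i := i)
  simp only [glue, Set.mem_ofPred_eq]
  split_ifs <;> simp [this.symm] <;> grind

theorem ncard_glue_spokeEnd {i : ℕ} :
    {l | glue n μ l (c i) = spokeEnd n i}.ncard = 2 := by
  rw [← ncard_colour (spokeColour n i)]
  congr 1
  ext l
  have : ∃ j, spokeEnd (P := P) n i = v j := by unfold spokeEnd; split <;> simp
  obtain ⟨j, hj⟩ := this
  simp only [glue, Set.mem_ofPred_eq]
  split_ifs <;> simp_all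

/-- One orientation per edge is enough, since `glue` is an involution on the vertices. Edges of
pieces, and those from `a i`, `b i` into pieces, inherit their count from the pieces. Tree edges
carry one colour class, and an edge at `c i` inside the junction gets the labels left over by two
disjoint pairs. -/
theorem exists_ncard_glue (H : IsGluable n μ) {e : Sym2 (ChenVertex P)}
    (he : IsEdge P (n + 1) e) : ∃ p q, e = s(p, q) ∧ {l | glue n μ l p = q}.ncard = 2 := by
  cases he with
  | piece i hi e he =>
    obtain ⟨w, w', hw, hx, hy, hx', hy', rfl⟩ := he
    refine ⟨_, _, rfl, ?_⟩
    rw [← (H.cover i hi).card _ _ hw]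
    congr 1
    ext l
    simp only [glue, port, Set.mem_ofPred_eq]
    split_ifs <;> simp <;> grind
  | a_y i hi =>
    refine ⟨_, _, rfl, ?_⟩
    rw [← (H.cover _ hi).card _ _ (P i).adj_y0]
    congr 1
    ext l
    simp only [glue, Set.mem_ofPred_eq]
    split_ifs <;> simp_all [next_ne]
  | b_y i hi =>
    refine ⟨_, _, rfl, ?_⟩
    rw [← (H.cover _ hi).card _ _ (P i).adj_y1]
    congr 1
    ext l
    simp only [glue, Set.mem_ofPred_eq]
    split_ifs <;> simp_all [next_ne]
  | a_c i hi =>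
    refine ⟨_, _, rfl, ?_⟩
    rw [← ncard_neither ((H.cover _ hi).card _ _ (P i).adj_y0)
      ((H.cover _ (next_lt hi)).card _ _ (P (next n i)).adj_x0)]
    · congr 1
      ext l
      simp only [glue, Set.mem_ofPred_eq, Set.mem_compl_iff, Set.mem_union]
      split_ifs <;> simp_all
    · refine Set.disjoint_left.2 fun l h1 h2 => ?_
      have hj := H.junction_cases hi l Iff.rfl Iff.rfl Iff.rfl Iff.rfl
      simp only [Set.mem_ofPred_eq] at h1 h2
      tauto
  | b_c i hi =>
    refine ⟨_, _, rfl, ?_⟩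
    rw [← ncard_neither ((H.cover _ hi).card _ _ (P i).adj_y1)
      ((H.cover _ (next_lt hi)).card _ _ (P (next n i)).adj_x1)]
    · congr 1
      ext l
      simp only [glue, Set.mem_ofPred_eq, Set.mem_compl_iff, Set.mem_union]
      split_ifs <;> simp_all
    · refine Set.disjoint_left.2 fun l h1 h2 => ?_
      have hj := H.junction_cases hi l Iff.rfl Iff.rfl Iff.rfl Iff.rfl
      simp only [Set.mem_ofPred_eq] at h1 h2
      tauto
  | a_x i hi =>
    refine ⟨_, _, rfl, ?_⟩
    have := ncard_glue_a_next H (i := i) (by omega)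
    rwa [next, if_neg (by omega)] at this
  | b_x i hi =>
    refine ⟨_, _, rfl, ?_⟩
    have := ncard_glue_b_next H (i := i) (by omega)
    rwa [next, if_neg (by omega)] at this
  | a_x_last =>
    refine ⟨_, _, rfl, ?_⟩
    have := ncard_glue_a_next H (i := n + 2) (by omega)
    rwa [next, if_pos rfl] at this
  | b_x_last =>
    refine ⟨_, _, rfl, ?_⟩
    have := ncard_glue_b_next H (i := n + 2) (by omega)
    rwa [next, if_pos rfl] at this
  | hub => exact ⟨_, _, by rw [hubEnd_add_three, spokeEnd], ncard_glue_spokeEnd (i := 0)⟩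
  | c_v j hj => exact ⟨_, _, rfl, ncard_glue_spokeEnd (i := j + 2)⟩
  | v_hub j hj =>
    refine ⟨_, _, rfl, ?_⟩
    refine (congrArg Set.ncard (Set.ext fun l => ?_)).trans (ncard_colour (altColour (j + 1)))
    have h1 := altColour_ne_zero j
    have h2 := altColour_ne_zero (j + 1)
    have h3 := altColour_succ_ne j
    have h4 := eq_or_eq_or_eq h1.symm h2.symm h3.symm l.1
    have h5 : hubEnd P (j + 2) ≠ c (j + 2) ∧ hubEnd P (j + 2) ≠ c 0 ∧
        hubEnd P (j + 2) ≠ v (j + 1) := by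
      cases j <;> simp [hubEnd_two, hubEnd_add_three, Nat.add_assoc]
    simp only [glue, Set.mem_ofPred_eq]
    split_ifs <;> grind

/-! ### Solving the parity conditions around the ring. -/

theorem exists_bits (n : ℕ) (γ : ℕ → Bool) : ∃ δ : ℕ → Fin 3 → Bool, ∀ i < n + 3,
    δ (next n i) (spokeColour n i) = xor (δ i (spokeColour n i)) (γ i) := by
  -- Spoke colour 0 occurs at junctions 2, …, n + 2, so its conditions run along the path of pieces
  -- 2, …, n + 2, 0 and are solved by partial sums. Junctions 0 and 1 have nonzero colours and both
  -- involve piece 1, whose bits are set to `false`.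
  let pre : ℕ → Bool := fun j => Nat.rec false (fun j s => xor s (γ (j + 2))) j
  refine ⟨fun i => match i with
    | 0 => fun c => if c = 0 then pre (n + 1) else γ 0
    | 1 => fun _ => false
    | j + 2 => fun c => if c = 0 then pre j else γ 1, fun i hi => ?_⟩
  match i with
  | 0 => simp [next, spokeColour, altColour_ne_zero]
  | 1 => simp [next, spokeColour]
  | j + 2 =>
    by_cases h : j = n
    · subst h; simp [next, spokeColour, pre]
    · simp [next, h, spokeColour, pre]

theorem exists_isGluable (hP : ∀ i < n + 3, HasFulkersonCover (P i).graph) :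
    ∃ μ : ∀ i, Fin 3 × Bool → (P i).V → (P i).V, IsGluable n μ := by
  have : ∀ i, ∃ β β' μ, i < n + 3 → IsSplitCover (P i) (pieceColour n i) β β' μ := by
    intro i
    by_cases hi : i < n + 3
    · obtain ⟨β, β', μ, H⟩ := exists_isSplitCover (P i) (hP i hi) (pieceColour n i)
      exact ⟨β, β', μ, fun _ => H⟩
    · exact ⟨fun _ => false, fun _ => false, fun _ w => w, fun h => absurd h hi⟩
  choose β β' μ H using this
  obtain ⟨δ, hδ⟩ := exists_bits n
    -- The negation is there because y0 must be matched with x1, whereas the bits `β` record x0.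
    fun i => !(xor (β' i (spokeColour n i)) (β (next n i) (spokeColour n i)))
  have H' := fun i hi => (H i hi).flip (δ i)
  refine ⟨fun i l => μ i (l.1, xor l.2 (δ i l.1)), fun i hi => (H' i hi).cover,
    fun i hi => (H' i hi).xy, ?_⟩
  rintro i hi ⟨c, b⟩ rfl
  obtain ⟨-, h1, h2⟩ := pieceColour_ne_next hi
  have hy := (H' i hi).y0 _ h1 b
  have hx := (H' _ (next_lt hi)).x0 _ h2 b
  have hxy := (H' _ (next_lt hi)).xy (spokeColour n i, b)
  have hadj := ((P (next n i)).adj_x_iff _).1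
    ((H' _ (next_lt hi)).cover.adj (spokeColour n i, b) (P (next n i)).x)
  have hne := (P (next n i)).x0_ne_x1
  have hx' : μ (next n i) (spokeColour n i, xor b (δ (next n i) (spokeColour n i)))
      (P (next n i)).x = (P (next n i)).x1 ↔
      ¬ b = xor (β (next n i) (spokeColour n i)) (δ (next n i) (spokeColour n i)) := by
    rw [← hx]
    constructor
    · intro h1 h2
      exact hne (h2.symm.trans h1)
    · intro h
      rcases hadj with h' | h' | h'
      · exact absurd (hxy.1 h') h2
      · exact absurd h' h
      · exact h'
  refine hy.trans (Iff.trans ?_ hx'.symm)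
  rw [hδ i hi]
  generalize β' i (spokeColour n i) = p
  generalize β (next n i) (spokeColour n i) = q
  generalize δ i (spokeColour n i) = r
  cases b <;> cases p <;> cases q <;> cases r <;> decide

theorem IsGluable.isPartnerCover (H : IsGluable n μ) :
    IsPartnerCover (chenGraph P (n + 3))
      fun l p => (⟨glue n μ l p.1, glue_mem l p.2⟩ : verts P (n + 3)) where
  adj l p := by
    have he := isEdge_glue H l p.2
    have := he.not_isDiag
    simpa [chenGraph, mem_edges_iff P (n + 1)] using ⟨he, this⟩
  invol l p := Subtype.ext (glue_glue H l p.2)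
  card p q hpq := by
    have he : IsEdge P (n + 1) s(p.1, q.1) := by
      simp only [chenGraph, SimpleGraph.comap_adj, SimpleGraph.fromEdgeSet_adj] at hpq
      exact (mem_edges_iff P (n + 1) _).1 hpq.1
    obtain ⟨p', q', heq, hcard⟩ := exists_ncard_glue H he
    rw [← hcard]
    congr 1
    ext l
    simp only [Set.mem_ofPred_eq, Subtype.ext_iff]
    rcases Sym2.eq_iff.1 heq with ⟨rfl, rfl⟩ | ⟨rfl, rfl⟩
    · rfl
    · constructor <;> intro hl
      · rw [← hl, glue_glue H l p.2]
      · rw [← hl, glue_glue H l q.2]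

end ChenVertex

theorem theorem1 (k : ℕ) (hk : 2 < k) {W : Type u} (Γ : SimpleGraph W)
    (hΓ : IsChenGraph k Γ) : HasFulkersonCover Γ := by
  obtain ⟨-, P, hP, ⟨φ⟩⟩ := hΓ
  -- Here `hk` is read as `3 ≤ k`, so that `k = n + 3` and the tree has at least the one inner
  -- vertex `v 0`.
  obtain ⟨n, rfl⟩ := Nat.exists_eq_add_of_le' hk
  obtain ⟨μ, H⟩ := ChenVertex.exists_isGluable (n := n) hP
  have e : Fin 6 ≃ Fin 3 × Bool := Fintype.equivOfCardEq (by simp)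
  exact ((H.isPartnerCover.comp_equiv e).congr_iso φ).hasFulkersonCover
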